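/- Let $X_1,\dots,X_n$ ($n\ge 1$) be i.i.d. random variables with the $N(\mu,\sigma^2)$ distribution, where $\mu\in\mathbb R$, $\sigma>0$, and consider the model with both parameters unknown: $\theta_0=(\mu,\sigma^2)$ is the true value of the parameter and $\Theta=\mathbb R\times(0,\infty)$ is the parameter space. Let $$\hat\theta_n(X)=\Big(\bar X,\ \tfrac1n\sum_{i=1}^n (X_i-\bar X)^2\Big)^{\intercal},\qquad \bar X=\tfrac1n\sum_{i=1}^n X_i ,$$ and let $I(\theta)=\big(\mathrm E_\theta[-\partial_{\theta_r}\partial_{\theta_s}\log f(X_1|\theta)]\big)_{r,s=1,2}$ be the expected Fisher information matrix of one observation, where $f(\cdot|\theta)$ is the normal density with parameter $\theta$; $[I(\theta_0)]^{1/2}$ is its positive semidefinite square root. (a) If $n\ge 2$, then almost surely $\hat\theta_n(X)$ is the unique maximiser over $\Theta$ of the likelihood $L(\theta;X)=\prod_{i=1}^n f(X_i|\theta)$, i.e. the unique maximum likelihood estimate. (b) Let $Z\sim N_2(0,I_{2\times 2})$ and let $h:\mathbb R^2\to\mathbb R$ be three times differentiable with bounded partial derivatives of orders 1, 2, 3.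 Write $\|\cdot\|$ for the supremum norm (with value $+\infty$ for an unbounded function), $\|h\|_1=\sup_i\|\partial_i h\|$, $\|h\|_2=\sup_{i,j}\|\partial_i\partial_j h\|$, $\|h\|_3=\sup_{i,j,k}\|\partial_i\partial_j\partial_k h\|$. Then $h\big(\sqrt n\,[I(\theta_0)]^{1/2}(\hat\theta_n(X)-\theta_0)\big)$ and $h(Z)$ are integrable and $$ \begin{aligned} &\Big|\mathrm E\big[h\big(\sqrt n\,[I(\theta_0)]^{1/2}(\hat\theta_n(X)-\theta_0)\big)\big]-\mathrm E[h(Z)]\Big| \le \frac52\frac{\|h\|_2}{\sqrt n}+19\frac{\|h\|_3}{\sqrt n}+8\frac{\|h\|}{n\sigma^2}\,(1+2\sigma^2)+4\sqrt2\,\frac{\|h\|_1}{\sqrt n}\\ &\qquad+4\frac{\|h\|_1}{\sqrt n}\Big[\sqrt2+\sqrt{\tfrac32}+16\sqrt2\sqrt{\tfrac1n+\tfrac{\sigma^2}{4}}\,\Big] +32\frac{\|h\|_1}{\sqrt n}\Big[1+648\Big[\Big(\tfrac32+\tfrac{\sigma^2}{4}\Big)^2+\tfrac{3}{n^2}\Big]\Big]^{1/2}.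 \end{aligned} $$ -/

import Mathlib

open MeasureTheory ProbabilityTheory
open scoped ENNReal MatrixOrder

noncomputable section

namespace NormalMLE

/-- The `i`-th partial derivative of `g : ℝᵈ → ℝ`, as a function on `ℝᵈ`. -/
def partialDeriv {d : ℕ} (i : Fin d) (g : EuclideanSpace ℝ (Fin d) → ℝ) :
    EuclideanSpace ℝ (Fin d) → ℝ :=
  fun x => lineDeriv ℝ g x (EuclideanSpace.single i 1)

/-- The supremum norm of a real function, with value `∞` for unbounded functions. -/
def supNorm {d : ℕ} (g : EuclideanSpace ℝ (Fin d) → ℝ) : ℝ≥0∞ :=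
  ⨆ x, ‖g x‖ₑ

/-- `‖h‖₁ = sup_i ‖∂_i h‖`. -/
def supNorm₁ {d : ℕ} (h : EuclideanSpace ℝ (Fin d) → ℝ) : ℝ≥0∞ :=
  ⨆ i, supNorm (partialDeriv i h)

/-- `‖h‖₂ = sup_{i,j} ‖∂_i ∂_j h‖`. -/
def supNorm₂ {d : ℕ} (h : EuclideanSpace ℝ (Fin d) → ℝ) : ℝ≥0∞ :=
  ⨆ i, ⨆ j, supNorm (partialDeriv i (partialDeriv j h))

/-- `‖h‖₃ = sup_{i,j,k} ‖∂_i ∂_j ∂_k h‖`. -/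
def supNorm₃ {d : ℕ} (h : EuclideanSpace ℝ (Fin d) → ℝ) : ℝ≥0∞ :=
  ⨆ i, ⨆ j, ⨆ k, supNorm (partialDeriv i (partialDeriv j (partialDeriv k h)))

/-- The class of test functions: three times differentiable functions `h : ℝᵈ → ℝ` whose partial
derivatives of orders one, two and three are bounded. -/
structure IsTestFunction {d : ℕ} (h : EuclideanSpace ℝ (Fin d) → ℝ) : Prop where
  differentiable : Differentiable ℝ h
  differentiable_first : ∀ i, Differentiable ℝ (partialDeriv i h)
  differentiable_second : ∀ i j, Differentiable ℝ (partialDeriv i (partialDeriv j h))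
  bounded_first : supNorm₁ h < ∞
  bounded_second : supNorm₂ h < ∞
  bounded_third : supNorm₃ h < ∞

/-- The parameter space of the model `N(μ, σ²)`, with parameter `θ = (μ, σ²)`:
`Θ = ℝ × (0, ∞)`. -/
def paramSpace : Set (EuclideanSpace ℝ (Fin 2)) :=
  {θ | 0 < θ 1}

/-- The density `f(x | θ)` of `N(μ, σ²)` at the parameter `θ = (μ, σ²)`. -/
def density (θ : EuclideanSpace ℝ (Fin 2)) (x : ℝ) : ℝ :=
  gaussianPDFReal (θ 0) (θ 1).toNNReal x

/-- The law `N(μ, σ²)` with parameter `θ = (μ, σ²)`. -/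
def law (θ : EuclideanSpace ℝ (Fin 2)) : Measure ℝ :=
  gaussianReal (θ 0) (θ 1).toNNReal

/-- The likelihood `L(θ; x) = ∏ᵢ f(xᵢ | θ)` of the data `x = (x₁, …, xₙ)`. -/
def likelihood {n : ℕ} (x : Fin n → ℝ) (θ : EuclideanSpace ℝ (Fin 2)) : ℝ :=
  ∏ i, density θ (x i)

/-- `t` is a maximum likelihood estimate for the data `x`: it lies in the parameter space and
maximises the likelihood there. -/
def IsMLE {n : ℕ} (x : Fin n → ℝ) (t : EuclideanSpace ℝ (Fin 2)) : Prop :=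
  t ∈ paramSpace ∧ IsMaxOn (likelihood x) paramSpace t

/-- The sample mean. -/
def sampleMean {n : ℕ} (x : Fin n → ℝ) : ℝ :=
  (∑ i, x i) / n

/-- The estimator `(x̄, (1/n) ∑ᵢ (xᵢ - x̄)²)`. -/
def estimator {n : ℕ} (x : Fin n → ℝ) : EuclideanSpace ℝ (Fin 2) :=
  !₂[sampleMean x, (∑ i, (x i - sampleMean x) ^ 2) / n]

/-- The expected Fisher information matrix of one observation,
`I(θ)_{rs} = E_θ[-∂²/∂θ_r∂θ_s log f(X | θ)]`. -/
def fisherInformation (θ : EuclideanSpace ℝ (Fin 2)) : Matrix (Fin 2) (Fin 2) ℝ :=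
  Matrix.of fun r s =>
    ∫ x, -partialDeriv r (partialDeriv s fun t => Real.log (density t x)) θ ∂(law θ)

/-- `√n I(θ₀)^{1/2} (t - θ₀)`, with the positive semidefinite square root of the matrix. -/
def standardize (n : ℕ) (θ₀ t : EuclideanSpace ℝ (Fin 2)) : EuclideanSpace ℝ (Fin 2) :=
  √(n : ℝ) • Matrix.toEuclideanCLM (𝕜 := ℝ) (CFC.sqrt (fisherInformation θ₀)) (t - θ₀)

end NormalMLE

end

/-!
The likelihood depends on the data only through the estimator `(x̄, s²)`, and
`log x < x - 1` for `x ≠ 1` shows that `θ = (x̄, s²)` is its unique maximiser, provided `0 < s²`;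
this holds almost surely for at least two independent observations with an atomless law.

For the normal approximation, let `Yᵢ = (Xᵢ - μ) / σ` and let `Uᵢ = (Yᵢ, (Yᵢ² - 1) / √2)` be the
score of `Xᵢ` multiplied by `I(θ₀)^(-1/2)`. Since `I(θ₀)` is diagonal,
`√n I(θ₀)^(1/2) (θ̂ - θ₀) = n^(-1/2) ∑ᵢ Uᵢ - (0, (∑ᵢ Yᵢ)² / (√2 n^(3/2)))`. The `Uᵢ` are i.i.d.,
centred with identity covariance, so replacing them one at a time by standard Gaussian vectors
changes `E h` at each step only by the remainders of the two second-order Taylor expansions, in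
total by `O(‖h‖₃ / √n)`. The last summand has `ℓ¹` norm of expectation `1 / √(2n)`, hence changes
`E h` by at most `‖h‖₁ / √(2n)`.
-/

namespace NormalMLE

section Taylor

theorem norm_taylor_two_le {E : Type*} [NormedAddCommGroup E] [NormedSpace ℝ E]
    {f f₁ f₂ f₃ : ℝ → E} {M : ℝ} (h₁ : ∀ t, HasDerivAt f (f₁ t) t)
    (h₂ : ∀ t, HasDerivAt f₁ (f₂ t) t) (h₃ : ∀ t, HasDerivAt f₂ (f₃ t) t) (hM : ∀ t, ‖f₃ t‖ ≤ M) :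
    ‖f 1 - f 0 - f₁ 0 - (1 / 2 : ℝ) • f₂ 0‖ ≤ M / 6 := by
  -- The quadratic Taylor polynomial of `f` at `t`, evaluated at `1`: differentiating in `t`, all
  -- terms but the one with `f₃` cancel.
  set g : ℝ → E := fun t => f t + (1 - t) • f₁ t + ((1 - t) ^ 2 / 2) • f₂ t with hg
  have hg' : ∀ t, HasDerivAt g (((1 - t) ^ 2 / 2) • f₃ t) t := fun t => by
    have hl : HasDerivAt (fun t : ℝ => 1 - t) (-1) t := by
      simpa using (hasDerivAt_id t).const_sub 1
    have hq : HasDerivAt (fun t : ℝ => (1 - t) ^ 2 / 2) (-(1 - t)) t :=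
      ((hl.pow 2).div_const 2).congr_deriv (by push_cast; ring)
    exact (((h₁ t).add (hl.smul (h₂ t))).add (hq.smul (h₃ t))).congr_deriv (by module)
  have hB : ∀ t, HasDerivAt (fun t : ℝ => M * (1 - (1 - t) ^ 3) / 6) (M * (1 - t) ^ 2 / 2) t :=
    fun t => by
      have hl : HasDerivAt (fun t : ℝ => 1 - t) (-1) t := by
        simpa using (hasDerivAt_id t).const_sub 1
      exact ((((hl.pow 3).const_sub 1).const_mul M).div_const 6).congr_deriv (by push_cast; ring)
  have hle : ‖g 1 - g 0‖ ≤ M * (1 - (1 - 1) ^ 3) / 6 := by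
    refine image_norm_le_of_norm_deriv_right_le_deriv_boundary (f := fun t => g t - g 0)
      (fun t _ => ((hg' t).sub_const _).continuousAt.continuousWithinAt)
      (fun t _ => ((hg' t).sub_const _).hasDerivWithinAt) (by simp) hB (fun t _ => ?_)
      (Set.right_mem_Icc.2 zero_le_one)
    rw [norm_smul, Real.norm_of_nonneg (by positivity)]
    exact (mul_le_mul_of_nonneg_left (hM t) (by positivity)).trans_eq (by ring)
  convert hle using 1
  · simp only [hg]
    congr 1
    module
  · ring

end Taylor

section TestFunctions

variable {d : ℕ} {g h : EuclideanSpace ℝ (Fin d) → ℝ}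

theorem abs_le_toReal_of_enorm_le {r : ℝ} {M : ℝ≥0∞} (hM : M < ∞) (hr : ‖r‖ₑ ≤ M) :
    |r| ≤ M.toReal := by
  rw [← Real.norm_eq_abs, ← toReal_enorm]
  exact ENNReal.toReal_mono hM.ne hr

theorem IsTestFunction.abs_partialDeriv_le (hh : IsTestFunction h) (i : Fin d)
    (x : EuclideanSpace ℝ (Fin d)) : |partialDeriv i h x| ≤ (supNorm₁ h).toReal :=
  abs_le_toReal_of_enorm_le hh.bounded_first <|
    le_iSup_of_le i (le_iSup_of_le (f := fun x => ‖partialDeriv i h x‖ₑ) x le_rfl)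

theorem IsTestFunction.abs_partialDeriv_partialDeriv_partialDeriv_le (hh : IsTestFunction h)
    (i j k : Fin d) (x : EuclideanSpace ℝ (Fin d)) :
    |partialDeriv i (partialDeriv j (partialDeriv k h)) x| ≤ (supNorm₃ h).toReal :=
  abs_le_toReal_of_enorm_le hh.bounded_third <|
    le_iSup_of_le i <| le_iSup_of_le j <| le_iSup_of_le k <|
      le_iSup_of_le (f := fun x => ‖partialDeriv i (partialDeriv j (partialDeriv k h)) x‖ₑ) x le_rfl

theorem hasDerivAt_comp_line (hg : Differentiable ℝ g) (x a : EuclideanSpace ℝ (Fin d)) (t : ℝ) :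
    HasDerivAt (fun t : ℝ => g (x + t • a)) (∑ i, a i * partialDeriv i g (x + t • a)) t := by
  have hline : HasDerivAt (fun t : ℝ => x + t • a) a t := by
    simpa using ((hasDerivAt_id t).smul_const a).const_add x
  refine ((hg (x + t • a)).hasFDerivAt.comp_hasDerivAt t hline).congr_deriv ?_
  conv_lhs => arg 2; rw [← (EuclideanSpace.basisFun (Fin d) ℝ).sum_repr a]
  simp [partialDeriv, (hg (x + t • a)).lineDeriv_eq_fderiv]

theorem abs_sum_mul_le {ι : Type*} {s : Finset ι} {a b : ι → ℝ} {M : ℝ}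
    (hb : ∀ i ∈ s, |b i| ≤ M) : |∑ i ∈ s, a i * b i| ≤ (∑ i ∈ s, |a i|) * M := by
  rw [Finset.sum_mul]
  refine (Finset.abs_sum_le_sum_abs _ _).trans (Finset.sum_le_sum fun i hi => ?_)
  rw [abs_mul]
  exact mul_le_mul_of_nonneg_left (hb i hi) (abs_nonneg _)

theorem IsTestFunction.abs_add_sub_le (hh : IsTestFunction h) (x a : EuclideanSpace ℝ (Fin d)) :
    |h (x + a) - h x| ≤ (supNorm₁ h).toReal * ∑ i, |a i| := by
  have key := norm_image_sub_le_of_norm_deriv_le_segment_01'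
    (fun t _ => (hasDerivAt_comp_line hh.differentiable x a t).hasDerivWithinAt)
    fun t _ => abs_sum_mul_le fun i _ => hh.abs_partialDeriv_le i (x + t • a)
  simpa [mul_comm] using key

theorem IsTestFunction.abs_taylor_le (hh : IsTestFunction h) (x a : EuclideanSpace ℝ (Fin d)) :
    |h (x + a) - h x - ∑ i, a i * partialDeriv i h x
      - (∑ i, ∑ j, a i * a j * partialDeriv j (partialDeriv i h) x) / 2|
      ≤ (supNorm₃ h).toReal / 6 * (∑ i, |a i|) ^ 3 := by
  have key := norm_taylor_two_le (hasDerivAt_comp_line hh.differentiable x a)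
    (fun t => HasDerivAt.fun_sum (u := Finset.univ) fun i _ =>
      (hasDerivAt_comp_line (hh.differentiable_first i) x a t).const_mul (a i))
    (fun t => HasDerivAt.fun_sum (u := Finset.univ) fun i _ =>
      (HasDerivAt.fun_sum (u := Finset.univ) fun j _ =>
        (hasDerivAt_comp_line (hh.differentiable_second j i) x a t).const_mul (a j)).const_mul
          (a i))
    fun t => abs_sum_mul_le fun i _ => abs_sum_mul_le fun j _ => abs_sum_mul_le fun k _ =>
      hh.abs_partialDeriv_partialDeriv_partialDeriv_le k j i (x + t • a)
  convert key using 1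
  · simp [Finset.mul_sum, mul_assoc, div_eq_inv_mul]
  · ring

theorem IsTestFunction.lipschitzWith (hh : IsTestFunction h) :
    LipschitzWith ((supNorm₁ h).toNNReal * d) h := by
  refine LipschitzWith.of_dist_le_mul fun x y => ?_
  have hcoord : ∀ i ∈ Finset.univ, |(x - y) i| ≤ dist x y := fun i _ => by
    rw [dist_eq_norm]
    exact PiLp.norm_apply_le (x - y) i
  calc dist (h x) (h y) ≤ (supNorm₁ h).toReal * ∑ i, |(x - y) i| := by
        simpa [Real.dist_eq] using hh.abs_add_sub_le y (x - y)
    _ ≤ (supNorm₁ h).toReal * (d * dist x y) := by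
        gcongr
        simpa using Finset.sum_le_card_nsmul _ _ _ hcoord
    _ = _ := by
        rw [NNReal.coe_mul, ENNReal.coe_toNNReal_eq_toReal, NNReal.coe_natCast, mul_assoc]

end TestFunctions

section Integrals

theorem integrable_comp_of_lipschitzWith {E Ω : Type*} [NormedAddCommGroup E]
    [MeasurableSpace Ω] {P : Measure Ω} [IsFiniteMeasure P] {h : E → ℝ} {K : NNReal}
    (hh : LipschitzWith K h) {V : Ω → E} (hV : Integrable V P) :
    Integrable (fun ω => h (V ω)) P := by
  have key : Integrable (fun ω => h (V ω) - h 0) P := memLp_one_iff_integrable.1 <|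
    (hh.sub (LipschitzWith.const (h 0))).comp_memLp (by simp) (memLp_one_iff_integrable.2 hV)
  simpa using key.fun_add (integrable_const (h 0))

theorem IsTestFunction.abs_integral_add_sub_le {d : ℕ} {h : EuclideanSpace ℝ (Fin d) → ℝ}
    {Ω : Type*} [MeasurableSpace Ω] {P : Measure Ω} [IsFiniteMeasure P] (hh : IsTestFunction h)
    {W D : Ω → EuclideanSpace ℝ (Fin d)} (hW : Integrable W P) (hD : Integrable D P) :
    |∫ ω, h (W ω + D ω) ∂P - ∫ ω, h (W ω) ∂P| ≤
      (supNorm₁ h).toReal * ∫ ω, ∑ i, |D ω i| ∂P := by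
  have hD₁ : Integrable (fun ω => ∑ i, |D ω i|) P := integrable_finsetSum _ fun i _ =>
    ((EuclideanSpace.proj (𝕜 := ℝ) i).integrable_comp hD).abs
  rw [← integral_sub (integrable_comp_of_lipschitzWith hh.lipschitzWith (hW.fun_add hD))
    (integrable_comp_of_lipschitzWith hh.lipschitzWith hW), ← integral_const_mul]
  exact norm_integral_le_of_norm_le (hD₁.const_mul _)
    (ae_of_all _ fun ω => (Real.norm_eq_abs _).trans_le (hh.abs_add_sub_le (W ω) (D ω)))

end Integrals

section MomentMatching

variable {d : ℕ} {h : EuclideanSpace ℝ (Fin d) → ℝ}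
  {Ω Ω' : Type*} [MeasurableSpace Ω] [MeasurableSpace Ω'] {P : Measure Ω} {Q : Measure Ω'}
  {A : Ω → EuclideanSpace ℝ (Fin d)} {B : Ω' → EuclideanSpace ℝ (Fin d)}

/-- The absolute third moment of a random vector in the `ℓ¹` norm, the norm in which the sum of the
third-order partial derivatives of a test function is bounded by `‖h‖₃`. -/
noncomputable def thirdMoment (A : Ω → EuclideanSpace ℝ (Fin d)) (P : Measure Ω) : ℝ :=
  ∫ ω, (∑ i, |A ω i|) ^ 3 ∂P

theorem integrable_sum_abs_pow_three (hA : ∀ i, MemLp (fun ω => A ω i) 3 P) :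
    Integrable (fun ω => (∑ i, |A ω i|) ^ 3) P := by
  have key := (memLp_finsetSum Finset.univ fun i _ => (hA i).abs).integrable_norm_pow (p := 3)
    (by norm_num)
  refine key.congr (ae_of_all _ fun ω => ?_)
  simp [abs_of_nonneg (Finset.sum_nonneg fun i _ => abs_nonneg (A ω i))]

theorem thirdMoment_smul (c : ℝ) (A : Ω → EuclideanSpace ℝ (Fin d)) (P : Measure Ω) :
    thirdMoment (fun ω => c • A ω) P = |c| ^ 3 * thirdMoment A P := by
  simp only [thirdMoment, PiLp.smul_apply, smul_eq_mul, abs_mul, ← Finset.mul_sum, mul_pow,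
    integral_const_mul]

theorem sum_pow_three_le {ι : Type*} (s : Finset ι) (a : ι → ℝ) :
    (∑ i ∈ s, |a i|) ^ 3 ≤ s.card ^ 2 / 2 * ∑ i ∈ s, (a i ^ 2 + a i ^ 4) := by
  have hterm : ∀ i ∈ s, |a i| ^ 3 ≤ (a i ^ 2 + a i ^ 4) / 2 := fun i _ => by
    rw [← (by decide : Even 2).pow_abs, ← (by decide : Even 4).pow_abs (a i)]
    nlinarith [mul_nonneg (sq_nonneg |a i|) (sq_nonneg (|a i| - 1))]
  have hpow := Real.rpow_sum_le_const_mul_sum_rpow s a (p := (3 : ℕ)) (by norm_num)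
  norm_num [Real.rpow_ofNat] at hpow
  calc (∑ i ∈ s, |a i|) ^ 3 ≤ s.card ^ 2 * ∑ i ∈ s, |a i| ^ 3 := hpow
    _ ≤ s.card ^ 2 * ∑ i ∈ s, (a i ^ 2 + a i ^ 4) / 2 := by gcongr with i hi; exact hterm i hi
    _ = _ := by rw [← Finset.sum_div]; ring

theorem thirdMoment_le [IsFiniteMeasure P] (hA : ∀ i, MemLp (fun ω => A ω i) 4 P) :
    thirdMoment A P ≤ (d : ℝ) ^ 2 / 2 * ∑ i, (∫ ω, A ω i ^ 2 ∂P + ∫ ω, A ω i ^ 4 ∂P) := by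
  have h₂ : ∀ i, Integrable (fun ω => A ω i ^ 2) P := fun i =>
    ((hA i).mono_exponent (by norm_num)).integrable_sq
  have h₄ : ∀ i, Integrable (fun ω => A ω i ^ 4) P := fun i => by
    simpa [(by decide : Even 4).pow_abs] using (hA i).integrable_norm_pow (p := 4) (by norm_num)
  simp only [← fun i => integral_add (h₂ i) (h₄ i)]
  rw [← integral_finsetSum _ fun i _ => (h₂ i).fun_add (h₄ i), ← integral_const_mul]
  refine integral_mono (integrable_sum_abs_pow_three fun i => (hA i).mono_exponent (by norm_num))
    ((integrable_finsetSum _ fun i _ => (h₂ i).add (h₄ i)).const_mul _) fun ω => ?_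
  simpa using sum_pow_three_le Finset.univ fun i => A ω i

theorem IsTestFunction.abs_integral_sub_taylor_le [IsProbabilityMeasure P]
    (hh : IsTestFunction h) (hA : ∀ i, MemLp (fun ω => A ω i) 3 P)
    (x : EuclideanSpace ℝ (Fin d)) :
    |∫ ω, h (x + A ω) ∂P - h x - ∑ i, (∫ ω, A ω i ∂P) * partialDeriv i h x
      - (∑ i, ∑ j, (∫ ω, A ω i * A ω j ∂P) * partialDeriv j (partialDeriv i h) x) / 2|
      ≤ (supNorm₃ h).toReal / 6 * thirdMoment A P := by
  have h₁ : ∀ i, Integrable (fun ω => A ω i) P := fun i => (hA i).integrable (by norm_num)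
  have h₂ : ∀ i j, Integrable (fun ω => A ω i * A ω j) P := fun i j =>
    ((hA i).mono_exponent (p := 2) (by norm_num)).integrable_mul
      ((hA j).mono_exponent (p := 2) (by norm_num))
  have hlin := integrable_finsetSum Finset.univ
    fun i _ => (h₁ i).mul_const (partialDeriv i h x)
  have hquad := integrable_finsetSum Finset.univ fun i _ => integrable_finsetSum Finset.univ
    fun j _ => (h₂ i j).mul_const (partialDeriv j (partialDeriv i h) x)
  have hcomp : Integrable (fun ω => h (x + A ω)) P := integrable_comp_of_lipschitzWith
    hh.lipschitzWith ((integrable_const x).add (Integrable.of_eval_piLp h₁))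
  have hincr : Integrable (fun ω => h (x + A ω) - h x) P := hcomp.sub (integrable_const _)
  have hrem : Integrable (fun ω => h (x + A ω) - h x - ∑ i, A ω i * partialDeriv i h x) P :=
    hincr.sub hlin
  calc _ = |∫ ω, (h (x + A ω) - h x - ∑ i, A ω i * partialDeriv i h x
        - (∑ i, ∑ j, A ω i * A ω j * partialDeriv j (partialDeriv i h) x) / 2) ∂P| := by
        rw [integral_sub hrem (hquad.div_const 2), integral_sub hincr hlin,
          integral_sub hcomp (integrable_const _), integral_div,
          integral_finsetSum _ fun i _ => (h₁ i).mul_const _, integral_finsetSum _ fun i _ =>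
            integrable_finsetSum _ fun j _ => (h₂ i j).mul_const _]
        simp only [integral_const, probReal_univ, one_smul, integral_mul_const,
          fun i => integral_finsetSum Finset.univ fun j _ =>
            (h₂ i j).mul_const (partialDeriv j (partialDeriv i h) x)]
    _ ≤ ∫ ω, (supNorm₃ h).toReal / 6 * (∑ i, |A ω i|) ^ 3 ∂P :=
        norm_integral_le_of_norm_le ((integrable_sum_abs_pow_three hA).const_mul _)
          (ae_of_all _ fun ω => (Real.norm_eq_abs _).trans_le (hh.abs_taylor_le x (A ω)))
    _ = _ := integral_const_mul _ _

theorem IsTestFunction.abs_integral_sub_integral_le [IsProbabilityMeasure P]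
    [IsProbabilityMeasure Q] (hh : IsTestFunction h) (hA : ∀ i, MemLp (fun ω => A ω i) 3 P)
    (hB : ∀ i, MemLp (fun ω => B ω i) 3 Q) (h₁ : ∀ i, ∫ ω, A ω i ∂P = ∫ ω, B ω i ∂Q)
    (h₂ : ∀ i j, ∫ ω, A ω i * A ω j ∂P = ∫ ω, B ω i * B ω j ∂Q) (x : EuclideanSpace ℝ (Fin d)) :
    |∫ ω, h (x + A ω) ∂P - ∫ ω, h (x + B ω) ∂Q| ≤
      (supNorm₃ h).toReal / 6 * (thirdMoment A P + thirdMoment B Q) := by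
  have tA := hh.abs_integral_sub_taylor_le hA x
  have tB := hh.abs_integral_sub_taylor_le hB x
  simp only [h₁, h₂] at tA
  rw [abs_le] at *
  constructor <;> linarith [tA.1, tA.2, tB.1, tB.2]

end MomentMatching

section Lindeberg

variable {E Ω Ω' : Type*} [NormedAddCommGroup E] [MeasurableSpace E] [BorelSpace E]
  [SecondCountableTopology E] [MeasurableSpace Ω] [MeasurableSpace Ω']
  {P : Measure Ω} {Q : Measure Ω'} {h : E → ℝ} {K : NNReal}

theorem abs_integral_add_sub_integral_prod_le [IsProbabilityMeasure P] [IsProbabilityMeasure Q]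
    (hh : LipschitzWith K h) {A B : Ω → E} {B' : Ω' → E} (hind : IndepFun A B P)
    (hA : Integrable A P) (hB : Integrable B P) (hB' : Integrable B' Q) {ε : ℝ}
    (hε : ∀ x, |∫ ω, h (x + B ω) ∂P - ∫ ω, h (x + B' ω) ∂Q| ≤ ε) (x : E) :
    |∫ ω, h (x + (A ω + B ω)) ∂P - ∫ z, h (x + (A z.1 + B' z.2)) ∂(P.prod Q)| ≤ ε := by
  have integrable_sum : Integrable (fun z : Ω × Ω => h (x + (A z.1 + B z.2))) (P.prod P) :=
    integrable_comp_of_lipschitzWith hh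
      ((integrable_const x).add ((hA.comp_fst P).add (hB.comp_snd P)))
  have integrable_sum' : Integrable (fun z : Ω × Ω' => h (x + (A z.1 + B' z.2))) (P.prod Q) :=
    integrable_comp_of_lipschitzWith hh
      ((integrable_const x).add ((hA.comp_fst Q).add (hB'.comp_snd P)))
  have lawA : HasLaw A (P.map A) P := ⟨hA.aemeasurable, rfl⟩
  have lawB : HasLaw B (P.map B) P := ⟨hB.aemeasurable, rfl⟩
  have hident : IdentDistrib (fun ω => (A ω, B ω)) (fun z : Ω × Ω => (A z.1, B z.2)) P
      (P.prod P) :=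
    (lawA.identDistrib (lawA.fun_comp measurePreserving_fst.hasLaw)).prodMk
      (lawB.identDistrib (lawB.fun_comp measurePreserving_snd.hasLaw)) hind
      (indepFun_prod₀ hA.aemeasurable hB.aemeasurable)
  have hcont : Continuous fun y : E × E => h (x + (y.1 + y.2)) :=
    hh.continuous.comp (by fun_prop)
  have hdecouple : ∫ ω, h (x + (A ω + B ω)) ∂P = ∫ z, h (x + (A z.1 + B z.2)) ∂(P.prod P) :=
    (hident.comp hcont.measurable).integral_eq
  rw [hdecouple, integral_prod _ integrable_sum, integral_prod _ integrable_sum',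
    ← integral_sub integrable_sum.integral_prod_left integrable_sum'.integral_prod_left]
  have key := norm_integral_le_of_norm_le_const (μ := P) (C := ε)
    (f := fun ω => ∫ ω', h (x + (A ω + B ω')) ∂P - ∫ ω', h (x + (A ω + B' ω')) ∂Q)
    (ae_of_all _ fun ω => by simpa only [add_assoc, Real.norm_eq_abs] using hε (x + A ω))
  simpa using key

theorem abs_integral_add_sub_integral_add_le [IsProbabilityMeasure P] [IsProbabilityMeasure Q]
    (hh : LipschitzWith K h) {A B : Ω → E} {A' B' : Ω' → E}
    (hind : IndepFun A B P) (hind' : IndepFun A' B' Q)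
    (hA : Integrable A P) (hB : Integrable B P) (hA' : Integrable A' Q) (hB' : Integrable B' Q)
    {δ ε : ℝ} (hδ : ∀ x, |∫ ω, h (x + A ω) ∂P - ∫ ω, h (x + A' ω) ∂Q| ≤ δ)
    (hε : ∀ x, |∫ ω, h (x + B ω) ∂P - ∫ ω, h (x + B' ω) ∂Q| ≤ ε) (x : E) :
    |∫ ω, h (x + (A ω + B ω)) ∂P - ∫ ω, h (x + (A' ω + B' ω)) ∂Q| ≤ δ + ε := by
  -- The intermediate quantity is the integral of `h (x + A + B')` with `A` and `B'` independent.
  have replace_second := abs_integral_add_sub_integral_prod_le hh hind hA hB hB' hε x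
  have replace_first := abs_integral_add_sub_integral_prod_le hh hind'.symm hB' hA' hA
    (fun x => abs_sub_comm (∫ ω, h (x + A ω) ∂P) _ ▸ hδ x) x
  rw [← integral_prod_swap] at replace_first
  simp only [Prod.fst_swap, Prod.snd_swap, add_comm (B' _)] at replace_first
  rw [abs_sub_comm] at replace_first
  exact (abs_sub_le _ _ _).trans ((add_le_add replace_second replace_first).trans_eq (add_comm _ _))

theorem abs_integral_sum_sub_integral_sum_le (hh : LipschitzWith K h) {ι : Type*} {U : ι → Ω → E}
    {V : ι → Ω' → E} (hU : iIndepFun U P) (hV : iIndepFun V Q) (hiU : ∀ i, Integrable (U i) P)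
    (hiV : ∀ i, Integrable (V i) Q) {ε : ι → ℝ}
    (hε : ∀ i x, |∫ ω, h (x + U i ω) ∂P - ∫ ω, h (x + V i ω) ∂Q| ≤ ε i) (s : Finset ι) (x : E) :
    |∫ ω, h (x + ∑ i ∈ s, U i ω) ∂P - ∫ ω, h (x + ∑ i ∈ s, V i ω) ∂Q| ≤ ∑ i ∈ s, ε i := by
  have := hU.isProbabilityMeasure
  have := hV.isProbabilityMeasure
  induction s using Finset.cons_induction generalizing x with
  | empty => simp
  | cons i s hi ih =>
    simp only [Finset.sum_cons]
    refine abs_integral_add_sub_integral_add_le hh ?_ ?_ (hiU i)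
      (integrable_finsetSum _ fun j _ => hiU j) (hiV i)
      (integrable_finsetSum _ fun j _ => hiV j) (hε i) ih x
    · simpa only [Finset.sum_fn] using
        (hU.indepFun_finsetSum_of_notMem₀ (fun j => (hiU j).aemeasurable) hi).symm
    · simpa only [Finset.sum_fn] using
        (hV.indepFun_finsetSum_of_notMem₀ (fun j => (hiV j).aemeasurable) hi).symm

end Lindeberg

section GaussianMoments

variable (m : ℝ) (v : NNReal)

theorem integrable_pow_gaussianReal (k : ℕ) :
    Integrable (fun x : ℝ => x ^ k) (gaussianReal m v) := by
  have key := (memLp_id_gaussianReal (μ := m) (v := v) k).integrable_norm_pow'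
  refine (integrable_norm_iff (by fun_prop)).1 (key.congr (ae_of_all _ fun x => ?_))
  simp

variable {v} in
theorem hasDerivAt_gaussianPDFReal (hv : v ≠ 0) (x : ℝ) :
    HasDerivAt (gaussianPDFReal m v) (-((x - m) / v) * gaussianPDFReal m v x) x := by
  have hexp : HasDerivAt (fun x : ℝ => -(x - m) ^ 2 / (2 * (v : ℝ))) (-((x - m) / v)) x :=
    ((((hasDerivAt_id x).sub_const m).pow 2).neg.div_const _).congr_deriv (by
      have : (v : ℝ) ≠ 0 := mod_cast hv
      simp only [id_eq]
      field_simp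
      ring)
  rw [gaussianPDFReal_def]
  exact (hexp.exp.const_mul _).congr_deriv (by ring)

-- Stein's identity for powers: integrate the derivative of `x ^ (k + 1)` times the density.
theorem integral_pow_add_two_gaussianReal (k : ℕ) :
    ∫ x, x ^ (k + 2) ∂(gaussianReal 0 v) = (k + 1) * v * ∫ x, x ^ k ∂(gaussianReal 0 v) := by
  rcases eq_or_ne v 0 with rfl | hv
  · simp [gaussianReal_zero_var]
  have hv' : (v : ℝ) ≠ 0 := mod_cast hv
  have hderiv : ∀ x, HasDerivAt (fun x => gaussianPDFReal 0 v x * x ^ (k + 1))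
      ((k + 1) * (gaussianPDFReal 0 v x * x ^ k) - gaussianPDFReal 0 v x * x ^ (k + 2) / v) x :=
    fun x => ((hasDerivAt_gaussianPDFReal 0 hv x).mul (hasDerivAt_pow (k + 1) x)).congr_deriv
      (by push_cast; ring_nf)
  have hmoment : ∀ j : ℕ, Integrable (fun x : ℝ => gaussianPDFReal 0 v x * x ^ j) := fun j => by
    have key := integrable_pow_gaussianReal 0 v j
    rw [gaussianReal_of_var_ne_zero 0 hv,
      integrable_withDensity_iff_integrable_smul' (measurable_gaussianPDF 0 v)
        (ae_of_all _ fun x => gaussianPDF_lt_top)] at key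
    simpa only [toReal_gaussianPDF, smul_eq_mul] using key
  have key := integral_eq_zero_of_hasDerivAt_of_integrable hderiv
    (((hmoment k).const_mul _).sub ((hmoment (k + 2)).div_const _)) (hmoment (k + 1))
  rw [integral_sub ((hmoment k).const_mul _) ((hmoment (k + 2)).div_const _), integral_const_mul,
    integral_div, sub_eq_zero, eq_div_iff hv'] at key
  simp only [integral_gaussianReal_eq_integral_smul hv, smul_eq_mul]
  linarith

theorem integral_pow_two_mul_gaussianReal (k : ℕ) :
    ∫ x, x ^ (2 * k) ∂(gaussianReal 0 v) = v ^ k * (2 * k - 1).doubleFactorial := by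
  induction k with
  | zero => simp
  | succ k ih =>
    rw [mul_add_one, integral_pow_add_two_gaussianReal, ih,
      show 2 * k + 2 - 1 = 2 * k + 1 by omega, Nat.doubleFactorial_add_one]
    push_cast
    ring

theorem integral_pow_two_mul_add_one_gaussianReal (k : ℕ) :
    ∫ x, x ^ (2 * k + 1) ∂(gaussianReal 0 v) = 0 := by
  induction k with
  | zero => simp
  | succ k ih => rw [mul_add_one, add_right_comm, integral_pow_add_two_gaussianReal, ih, mul_zero]

theorem integral_octic_gaussianReal {f : ℝ → ℝ} (a : Fin 9 → ℝ)
    (hf : ∀ x, f x = ∑ i, a i * x ^ (i : ℕ)) :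
    ∫ x, f x ∂(gaussianReal 0 1) = a 0 + a 2 + 3 * a 4 + 15 * a 6 + 105 * a 8 := by
  have odd := integral_pow_two_mul_add_one_gaussianReal 1
  have even := integral_pow_two_mul_gaussianReal 1
  have moments : ∀ i : Fin 9, ∫ x, x ^ (i : ℕ) ∂(gaussianReal 0 1)
      = (![1, 0, 1, 0, 3, 0, 15, 0, 105] : Fin 9 → ℝ) i := fun i => by
    fin_cases i
    exacts [by simp, odd 0, by simpa using even 1, odd 1,
      by simpa [Nat.doubleFactorial] using even 2, odd 2,
      by simpa [Nat.doubleFactorial] using even 3, odd 3,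
      by simpa [Nat.doubleFactorial] using even 4]
  simp only [hf]
  rw [integral_finsetSum Finset.univ fun (i : Fin 9) _ =>
    (integrable_pow_gaussianReal 0 1 i).const_mul (a i)]
  simp only [integral_const_mul, moments]
  simp [Fin.sum_univ_succ]
  ring

end GaussianMoments

section Standardized

variable {d : ℕ} {Ω Ω' : Type*} [MeasurableSpace Ω] [MeasurableSpace Ω'] {P : Measure Ω}
  {Q : Measure Ω'} {A : Ω → EuclideanSpace ℝ (Fin d)}

/-- A random vector with finite third moments is standardized if it is centred and its coordinates
are uncorrelated with variance one, i.e. if its first two moments are those of the standard Gaussian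
law. -/
structure IsStandardized (A : Ω → EuclideanSpace ℝ (Fin d)) (P : Measure Ω) : Prop where
  memLp_three : ∀ i, MemLp (fun ω => A ω i) 3 P
  integral_apply : ∀ i, ∫ ω, A ω i ∂P = 0
  integral_apply_mul_apply : ∀ i j, ∫ ω, A ω i * A ω j ∂P = if i = j then 1 else 0

theorem IsStandardized.integrable [IsFiniteMeasure P] (hA : IsStandardized A P) :
    Integrable A P :=
  Integrable.of_eval_piLp fun i => (hA.memLp_three i).integrable (by norm_num)

theorem IsStandardized.comp_hasLaw (hA : IsStandardized A P) {Y : Ω' → Ω} (hY : HasLaw Y P Q) :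
    IsStandardized (fun ω => A (Y ω)) Q where
  memLp_three i := by
    have key := hA.memLp_three i
    rw [← hY.map_eq] at key
    exact key.comp_of_map hY.aemeasurable
  integral_apply i :=
    (hY.integral_comp (hA.memLp_three i).aestronglyMeasurable).trans (hA.integral_apply i)
  integral_apply_mul_apply i j :=
    (hY.integral_comp ((hA.memLp_three i).aestronglyMeasurable.mul
      (hA.memLp_three j).aestronglyMeasurable)).trans (hA.integral_apply_mul_apply i j)

theorem IsStandardized.thirdMoment_comp_hasLaw (hA : IsStandardized A P) {Y : Ω' → Ω}
    (hY : HasLaw Y P Q) : thirdMoment (fun ω => A (Y ω)) Q = thirdMoment A P :=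
  hY.integral_comp (integrable_sum_abs_pow_three hA.memLp_three).aestronglyMeasurable

theorem hasLaw_apply_stdGaussian (i : Fin d) :
    HasLaw (fun x : EuclideanSpace ℝ (Fin d) => x i) (gaussianReal 0 1) (stdGaussian _) := by
  simpa using (measurePreserving_eval_multivariateGaussian (μ := (0 : EuclideanSpace ℝ (Fin d)))
    (Matrix.PosSemidef.one (n := Fin d) (R := ℝ)) (i := i)).hasLaw

theorem memLp_apply_stdGaussian (i : Fin d) (p : NNReal) :
    MemLp (fun x : EuclideanSpace ℝ (Fin d) => x i) p (stdGaussian _) := by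
  have key := memLp_id_gaussianReal (μ := 0) (v := 1) p
  rw [← (hasLaw_apply_stdGaussian i).map_eq] at key
  exact key.comp_of_map (hasLaw_apply_stdGaussian i).aemeasurable

theorem isStandardized_stdGaussian :
    IsStandardized (fun x : EuclideanSpace ℝ (Fin d) => x) (stdGaussian _) where
  memLp_three i := memLp_apply_stdGaussian i 3
  integral_apply i := (hasLaw_apply_stdGaussian i).integral_eq.trans integral_id_gaussianReal
  integral_apply_mul_apply i j := by
    have key := covariance_eval_multivariateGaussian (μ := (0 : EuclideanSpace ℝ (Fin d)))
      (Matrix.PosSemidef.one (n := Fin d) (R := ℝ)) i j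
    rwa [multivariateGaussian_zero_one, covariance_eq_sub (memLp_apply_stdGaussian i 2)
      (memLp_apply_stdGaussian j 2), (hasLaw_apply_stdGaussian i).integral_eq,
      integral_id_gaussianReal, zero_mul, sub_zero, Matrix.one_apply] at key

theorem thirdMoment_stdGaussian_le :
    thirdMoment (fun x : EuclideanSpace ℝ (Fin d) => x) (stdGaussian _) ≤ 2 * d ^ 3 := by
  have moment : ∀ (i : Fin d) (k : ℕ), ∫ x : EuclideanSpace ℝ (Fin d), x i ^ k ∂(stdGaussian _)
      = ∫ x, x ^ k ∂(gaussianReal 0 1) := fun i k =>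
    (hasLaw_apply_stdGaussian i).integral_comp (continuous_pow k).aestronglyMeasurable
  have even := integral_pow_two_mul_gaussianReal 1
  have m₂ : ∫ x, x ^ 2 ∂(gaussianReal 0 1) = 1 := by simpa using even 1
  have m₄ : ∫ x, x ^ 4 ∂(gaussianReal 0 1) = 3 := by simpa [Nat.doubleFactorial] using even 2
  refine (thirdMoment_le fun i => memLp_apply_stdGaussian i 4).trans_eq ?_
  simp only [moment, m₂, m₄, Finset.sum_const, Finset.card_univ, Fintype.card_fin, nsmul_eq_mul]
  ring

theorem hasLaw_inv_sqrt_smul_sum_pi_stdGaussian {ι E : Type*} [Fintype ι] [Nonempty ι]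
    [NormedAddCommGroup E] [InnerProductSpace ℝ E] [FiniteDimensional ℝ E] [MeasurableSpace E]
    [BorelSpace E] :
    HasLaw (fun x : ι → E => (√(Fintype.card ι : ℝ))⁻¹ • ∑ i, x i) (stdGaussian E)
      (Measure.pi fun _ => stdGaussian E) where
  map_eq := by
    refine Measure.ext_of_charFun (funext fun t => ?_)
    rw [charFun_map_smul_comp (by fun_prop), charFun_map_sum_pi_eq_prod, Finset.prod_apply]
    have card_ne_zero : (Fintype.card ι : ℝ) ≠ 0 := mod_cast Fintype.card_ne_zero
    have norm_sq : Fintype.card ι * ‖(√(Fintype.card ι : ℝ))⁻¹ • t‖ ^ 2 = ‖t‖ ^ 2 := by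
      rw [norm_smul, mul_pow, Real.norm_eq_abs, sq_abs, inv_pow, Real.sq_sqrt (Nat.cast_nonneg _),
        mul_inv_cancel_left₀ card_ne_zero]
    simp only [charFun_stdGaussian, ← Complex.exp_sum, Finset.sum_const, Finset.card_univ,
      nsmul_eq_mul, ← Complex.ofReal_pow, ← norm_sq]
    push_cast
    ring_nf

theorem IsTestFunction.abs_integral_smul_sub_integral_smul_le [IsProbabilityMeasure P]
    [IsProbabilityMeasure Q] {h : EuclideanSpace ℝ (Fin d) → ℝ} (hh : IsTestFunction h)
    {B : Ω' → EuclideanSpace ℝ (Fin d)} (hA : IsStandardized A P) (hB : IsStandardized B Q)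
    (c : ℝ) (x : EuclideanSpace ℝ (Fin d)) :
    |∫ ω, h (x + c • A ω) ∂P - ∫ ω, h (x + c • B ω) ∂Q| ≤
      (supNorm₃ h).toReal / 6 * (|c| ^ 3 * (thirdMoment A P + thirdMoment B Q)) := by
  have key := hh.abs_integral_sub_integral_le (A := fun ω => c • A ω) (B := fun ω => c • B ω)
    (fun i => (hA.memLp_three i).const_mul c) (fun i => (hB.memLp_three i).const_mul c)
    (fun i => by simp only [PiLp.smul_apply, smul_eq_mul, integral_const_mul, hA.integral_apply,
      hB.integral_apply])
    (fun i j => by simp only [PiLp.smul_apply, smul_eq_mul, mul_mul_mul_comm c,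
      integral_const_mul, hA.integral_apply_mul_apply, hB.integral_apply_mul_apply]) x
  rwa [thirdMoment_smul, thirdMoment_smul, ← mul_add] at key

theorem IsTestFunction.abs_integral_inv_sqrt_smul_sum_sub_le {ι : Type*} [Fintype ι] [Nonempty ι]
    {h : EuclideanSpace ℝ (Fin d) → ℝ} (hh : IsTestFunction h)
    {U : ι → Ω → EuclideanSpace ℝ (Fin d)} (hU : ∀ i, IsStandardized (U i) P)
    (hind : iIndepFun U P) :
    |∫ ω, h ((√(Fintype.card ι : ℝ))⁻¹ • ∑ i, U i ω) ∂P - ∫ x, h x ∂(stdGaussian _)| ≤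
      (supNorm₃ h).toReal / 6 * ((√(Fintype.card ι : ℝ))⁻¹ ^ 3 * ∑ i, (thirdMoment (U i) P
        + thirdMoment (fun x : EuclideanSpace ℝ (Fin d) => x) (stdGaussian _))) := by
  have := hind.isProbabilityMeasure
  set c := (√(Fintype.card ι : ℝ))⁻¹
  let γ := stdGaussian (EuclideanSpace ℝ (Fin d))
  have eval_law : ∀ i : ι, HasLaw (fun x : ι → EuclideanSpace ℝ (Fin d) => x i) γ
      (Measure.pi fun _ => γ) := fun i => (measurePreserving_eval (fun _ => γ) i).hasLaw
  have hV := fun i => isStandardized_stdGaussian.comp_hasLaw (eval_law i)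
  have hVind : iIndepFun (fun i (x : ι → EuclideanSpace ℝ (Fin d)) => c • x i)
      (Measure.pi fun _ => γ) :=
    iIndepFun_pi (X := fun _ x => c • x) fun _ => by fun_prop
  have key := abs_integral_sum_sub_integral_sum_le hh.lipschitzWith
    (hind.comp (fun _ x => c • x) fun _ => by fun_prop) hVind
    (fun i => (hU i).integrable.smul c) (fun i => (hV i).integrable.smul c)
    (fun i => hh.abs_integral_smul_sub_integral_smul_le (hU i) (hV i) c) Finset.univ 0
  rw [← hasLaw_inv_sqrt_smul_sum_pi_stdGaussian (ι := ι).integral_comp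
    hh.differentiable.continuous.aestronglyMeasurable]
  simpa only [zero_add, ← Finset.smul_sum, ← Finset.mul_sum, Function.comp_def,
    isStandardized_stdGaussian.thirdMoment_comp_hasLaw (eval_law _),
    abs_of_nonneg (show 0 ≤ c by positivity)] using key

end Standardized

section ScoreVector

theorem memLp_pow_gaussianReal (m : ℝ) (v : NNReal) (k : ℕ) (p : NNReal) :
    MemLp (fun x : ℝ => x ^ k) p (gaussianReal m v) := by
  rcases eq_or_ne k 0 with rfl | hk
  · simpa using memLp_const (1 : ℝ)
  · have key := (memLp_id_gaussianReal (μ := m) (v := v) (p * k)).norm_rpow_div k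
    push_cast at key
    rw [ENNReal.mul_div_cancel_right (mod_cast hk) (by finiteness)] at key
    exact (memLp_norm_iff (by fun_prop)).1 (by simpa using key)

/-- The score of one observation `x` of `N(μ, σ²)`, multiplied by `I(μ, σ²)^{-1/2}`, as a function
of `y = (x - μ) / σ`: the first two orthonormal Hermite polynomials. -/
noncomputable def scoreVector (y : ℝ) : EuclideanSpace ℝ (Fin 2) := !₂[y, (y ^ 2 - 1) / √2]

@[simp]
theorem scoreVector_zero (y : ℝ) : scoreVector y 0 = y := rfl

@[simp]
theorem scoreVector_one (y : ℝ) : scoreVector y 1 = (y ^ 2 - 1) / √2 := rfl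

@[fun_prop]
theorem continuous_scoreVector : Continuous scoreVector := by
  refine (PiLp.continuous_toLp 2 _).comp (continuous_pi fun i => ?_)
  fin_cases i
  exacts [continuous_id, by fun_prop]

theorem memLp_scoreVector (p : NNReal) (i : Fin 2) :
    MemLp (fun y => scoreVector y i) p (gaussianReal 0 1) := by
  fin_cases i
  · exact memLp_id_gaussianReal p
  · exact (((memLp_pow_gaussianReal 0 1 2 p).sub (memLp_const 1)).const_mul (√2)⁻¹).congr_norm
      (by fun_prop) (ae_of_all _ fun y => by simp [div_eq_inv_mul])

theorem isStandardized_scoreVector : IsStandardized scoreVector (gaussianReal 0 1) where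
  memLp_three := memLp_scoreVector 3
  integral_apply i := by
    fin_cases i
    · exact integral_id_gaussianReal
    · refine (integral_octic_gaussianReal ![-1 / √2, 0, 1 / √2, 0, 0, 0, 0, 0, 0] fun y => ?_).trans
        (by simp [neg_div])
      simp [Fin.sum_univ_succ]
      ring
  integral_apply_mul_apply i j := by
    have cross (y : ℝ) : y * ((y ^ 2 - 1) / √2)
        = ∑ i, ![0, -1 / √2, 0, 1 / √2, 0, 0, 0, 0, 0] i * y ^ (i : ℕ) := by
      simp [Fin.sum_univ_succ]
      ring
    have square (y : ℝ) : (y ^ 2 - 1) / √2 * ((y ^ 2 - 1) / √2)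
        = ∑ i, ![1 / 2, 0, -1, 0, 1 / 2, 0, 0, 0, 0] i * y ^ (i : ℕ) := by
      rw [div_mul_div_comm, Real.mul_self_sqrt (by norm_num)]
      simp [Fin.sum_univ_succ]
      ring
    fin_cases i <;> fin_cases j
    · refine (integral_octic_gaussianReal ![0, 0, 1, 0, 0, 0, 0, 0, 0] fun y => ?_).trans (by simp)
      simp [Fin.sum_univ_succ, sq]
    · exact (integral_octic_gaussianReal _ cross).trans (by simp)
    · exact (integral_octic_gaussianReal _ fun y => (mul_comm _ _).trans (cross y)).trans (by simp)
    · exact (integral_octic_gaussianReal _ square).trans (by simp; norm_num)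

theorem thirdMoment_scoreVector_le : thirdMoment scoreVector (gaussianReal 0 1) ≤ 40 := by
  have fourth (y : ℝ) : ((y ^ 2 - 1) / √2) ^ 4
      = ∑ i, ![1 / 4, 0, -1, 0, 3 / 2, 0, -1, 0, 1 / 4] i * y ^ (i : ℕ) := by
    rw [div_pow, show √2 ^ 4 = (√2 ^ 2) ^ 2 by ring, Real.sq_sqrt (by norm_num)]
    simp [Fin.sum_univ_succ]
    ring
  have m₂ : ∀ i, ∫ y, scoreVector y i ^ 2 ∂(gaussianReal 0 1) = 1 := fun i => by
    simpa [sq] using isStandardized_scoreVector.integral_apply_mul_apply i i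
  have m₄ : ∫ y, y ^ 4 ∂(gaussianReal 0 1) = 3 := by
    simpa [Nat.doubleFactorial] using integral_pow_two_mul_gaussianReal 1 2
  refine (thirdMoment_le (memLp_scoreVector 4)).trans_eq ?_
  simp only [Fin.sum_univ_two, m₂, scoreVector_zero, scoreVector_one, m₄,
    integral_octic_gaussianReal _ fourth]
  simp
  norm_num

theorem IsTestFunction.abs_integral_sum_scoreVector_sub_le {Ω : Type*} [MeasurableSpace Ω]
    {P : Measure Ω} {n : ℕ} [NeZero n]
    {h : EuclideanSpace ℝ (Fin 2) → ℝ} (hh : IsTestFunction h) {Y : Fin n → Ω → ℝ}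
    (hY : ∀ i, HasLaw (Y i) (gaussianReal 0 1) P) (hind : iIndepFun Y P) :
    |∫ ω, h ((√n)⁻¹ • ∑ i, scoreVector (Y i ω)) ∂P - ∫ x, h x ∂(stdGaussian _)| ≤
      28 / 3 / √n * (supNorm₃ h).toReal := by
  have sqrt_pos : 0 < √(n : ℝ) := Real.sqrt_pos.2 (mod_cast NeZero.pos n)
  have key := hh.abs_integral_inv_sqrt_smul_sum_sub_le
    (fun i => isStandardized_scoreVector.comp_hasLaw (hY i))
    (hind.comp (fun _ => scoreVector) fun _ => by fun_prop)
  have third_moments : ∀ i, thirdMoment (fun ω => scoreVector (Y i ω)) P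
      + thirdMoment (fun x : EuclideanSpace ℝ (Fin 2) => x) (stdGaussian _) ≤ 56 := fun i => by
    rw [isStandardized_scoreVector.thirdMoment_comp_hasLaw (hY i)]
    have gaussian := thirdMoment_stdGaussian_le (d := 2)
    norm_num at gaussian
    linarith [thirdMoment_scoreVector_le]
  rw [Fintype.card_fin] at key
  calc _ ≤ _ := key
    _ ≤ (supNorm₃ h).toReal / 6 * ((√n)⁻¹ ^ 3 * ∑ _i : Fin n, 56) := by
      gcongr with i
      exact third_moments i
    _ = (supNorm₃ h).toReal / 6 * ((√n)⁻¹ ^ 3 * (√n ^ 2 * 56)) := by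
      simp [Real.sq_sqrt]
    _ = _ := by field_simp; ring

end ScoreVector

section Fisher

variable {θ : EuclideanSpace ℝ (Fin 2)}

theorem density_pos (hθ : θ ∈ paramSpace) (x : ℝ) : 0 < density θ x :=
  gaussianPDFReal_pos _ _ _ (Real.toNNReal_pos.2 hθ).ne'

theorem log_density (hθ : θ ∈ paramSpace) (x : ℝ) :
    Real.log (density θ x)
      = -(Real.log (2 * Real.pi) / 2) - Real.log (θ 1) / 2 - (x - θ 0) ^ 2 / (2 * θ 1) := by
  have hθ₁ : 0 < θ 1 := hθ
  rw [density, gaussianPDFReal, Real.coe_toNNReal _ hθ₁.le,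
    Real.log_mul (by positivity) (Real.exp_ne_zero _), Real.log_exp, Real.log_inv,
    Real.log_sqrt (by positivity), Real.log_mul (by positivity) hθ₁.ne']
  ring

theorem nullSingletonClass_law (hθ : θ ∈ paramSpace) : NullSingletonClass (law θ) :=
  nullSingletonClass_gaussianReal (Real.toNNReal_pos.2 hθ).ne'

theorem isOpen_paramSpace : IsOpen paramSpace :=
  isOpen_lt continuous_const (by fun_prop)

section PartialDeriv

variable {g : EuclideanSpace ℝ (Fin 2) → ℝ} {G : ℝ → ℝ → ℝ} {D : ℝ}

theorem partialDeriv_zero_eq (hθ : θ ∈ paramSpace) (hg : ∀ t ∈ paramSpace, g t = G (t 0) (t 1))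
    (hD : HasDerivAt (fun m => G m (θ 1)) D (θ 0)) : partialDeriv 0 g θ = D := by
  have heq := Filter.eventuallyEq_of_mem (isOpen_paramSpace.mem_nhds hθ) hg
  refine heq.lineDeriv_eq.trans (HasDerivAt.deriv ?_)
  simpa using HasDerivAt.comp_const_add (θ 0) 0 (by simpa using hD)

theorem partialDeriv_one_eq (hθ : θ ∈ paramSpace) (hg : ∀ t ∈ paramSpace, g t = G (t 0) (t 1))
    (hD : HasDerivAt (fun v => G (θ 0) v) D (θ 1)) : partialDeriv 1 g θ = D := by
  have heq := Filter.eventuallyEq_of_mem (isOpen_paramSpace.mem_nhds hθ) hg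
  refine heq.lineDeriv_eq.trans (HasDerivAt.deriv ?_)
  simpa using HasDerivAt.comp_const_add (θ 1) 0 (by simpa using hD)

end PartialDeriv

theorem partialDeriv_zero_log_density (hθ : θ ∈ paramSpace) (x : ℝ) :
    partialDeriv 0 (fun t => Real.log (density t x)) θ = (x - θ 0) / θ 1 := by
  refine partialDeriv_zero_eq hθ (fun t ht => log_density ht x) (G := fun m v =>
    -(Real.log (2 * Real.pi) / 2) - Real.log v / 2 - (x - m) ^ 2 / (2 * v)) ?_
  refine (((((hasDerivAt_id (θ 0)).const_sub x).fun_pow 2).div_const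
    (2 * θ 1)).const_sub _).congr_deriv ?_
  simp only [id_eq]
  ring

theorem partialDeriv_one_log_density (hθ : θ ∈ paramSpace) (x : ℝ) :
    partialDeriv 1 (fun t => Real.log (density t x)) θ
      = -(1 / (2 * θ 1)) + (x - θ 0) ^ 2 / (2 * θ 1 ^ 2) := by
  have hθ₁ : θ 1 ≠ 0 := (show 0 < θ 1 from hθ).ne'
  refine partialDeriv_one_eq hθ (fun t ht => log_density ht x) (G := fun m v =>
    -(Real.log (2 * Real.pi) / 2) - Real.log v / 2 - (x - m) ^ 2 / (2 * v)) ?_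
  refine ((((Real.hasDerivAt_log hθ₁).div_const 2).const_sub _).fun_sub
    ((hasDerivAt_const _ ((x - θ 0) ^ 2)).fun_div ((hasDerivAt_id (θ 1)).const_mul 2)
      (mul_ne_zero two_ne_zero hθ₁))).congr_deriv ?_
  simp only [id_eq]
  field_simp
  ring

theorem partialDeriv_zero_zero_log_density (hθ : θ ∈ paramSpace) (x : ℝ) :
    partialDeriv 0 (partialDeriv 0 fun t => Real.log (density t x)) θ = -(1 / θ 1) := by
  refine partialDeriv_zero_eq hθ (fun t ht => partialDeriv_zero_log_density ht x)
    (G := fun m v => (x - m) / v) ?_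
  exact (((hasDerivAt_id (θ 0)).const_sub x).div_const (θ 1)).congr_deriv (neg_div _ _)

theorem partialDeriv_one_zero_log_density (hθ : θ ∈ paramSpace) (x : ℝ) :
    partialDeriv 1 (partialDeriv 0 fun t => Real.log (density t x)) θ
      = -((x - θ 0) / θ 1 ^ 2) := by
  refine partialDeriv_one_eq hθ (fun t ht => partialDeriv_zero_log_density ht x)
    (G := fun m v => (x - m) / v) ?_
  exact ((hasDerivAt_const _ (x - θ 0)).fun_div (hasDerivAt_id (θ 1))
    (show 0 < θ 1 from hθ).ne').congr_deriv (by simp only [id_eq]; ring)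

theorem partialDeriv_zero_one_log_density (hθ : θ ∈ paramSpace) (x : ℝ) :
    partialDeriv 0 (partialDeriv 1 fun t => Real.log (density t x)) θ
      = -((x - θ 0) / θ 1 ^ 2) := by
  refine partialDeriv_zero_eq hθ (fun t ht => partialDeriv_one_log_density ht x)
    (G := fun m v => -(1 / (2 * v)) + (x - m) ^ 2 / (2 * v ^ 2)) ?_
  refine (((((hasDerivAt_id (θ 0)).const_sub x).fun_pow 2).div_const
    (2 * θ 1 ^ 2)).const_add _).congr_deriv ?_
  simp only [id_eq]
  ring

theorem partialDeriv_one_one_log_density (hθ : θ ∈ paramSpace) (x : ℝ) :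
    partialDeriv 1 (partialDeriv 1 fun t => Real.log (density t x)) θ
      = 1 / (2 * θ 1 ^ 2) - (x - θ 0) ^ 2 / θ 1 ^ 3 := by
  have hθ₁ : θ 1 ≠ 0 := (show 0 < θ 1 from hθ).ne'
  refine partialDeriv_one_eq hθ (fun t ht => partialDeriv_one_log_density ht x)
    (G := fun m v => -(1 / (2 * v)) + (x - m) ^ 2 / (2 * v ^ 2)) ?_
  refine ((((hasDerivAt_const _ 1).fun_div ((hasDerivAt_id (θ 1)).const_mul 2)
      (mul_ne_zero two_ne_zero hθ₁)).fun_neg).fun_add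
    ((hasDerivAt_const _ ((x - θ 0) ^ 2)).fun_div (((hasDerivAt_id (θ 1)).fun_pow 2).const_mul 2)
      (mul_ne_zero two_ne_zero (pow_ne_zero 2 hθ₁)))).congr_deriv ?_
  simp only [id_eq]
  field_simp
  ring

theorem fisherInformation_eq (hθ : θ ∈ paramSpace) :
    fisherInformation θ = Matrix.diagonal ![1 / θ 1, 1 / (2 * θ 1 ^ 2)] := by
  have hθ₁ : 0 < θ 1 := hθ
  have : IsProbabilityMeasure (law θ) := by unfold law; infer_instance
  have integrable_id : Integrable (fun x : ℝ => x) (law θ) := 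
    (memLp_id_gaussianReal 1).integrable le_rfl
  have integrable_sq : Integrable (fun x : ℝ => (x - θ 0) ^ 2) (law θ) :=
    ((memLp_id_gaussianReal 2).sub (memLp_const (θ 0))).integrable_sq
  have mean : ∫ x, (x - θ 0) ∂(law θ) = 0 := by
    rw [integral_sub integrable_id (integrable_const _)]
    simp [law]
  have variance : ∫ x, (x - θ 0) ^ 2 ∂(law θ) = θ 1 := by
    have key := variance_fun_id_gaussianReal (μ := θ 0) (v := (θ 1).toNNReal)
    rwa [variance_eq_integral (by fun_prop), integral_id_gaussianReal,
      Real.coe_toNNReal _ hθ₁.le] at key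
  ext r s
  fin_cases r <;> fin_cases s
  · simp [fisherInformation, partialDeriv_zero_zero_log_density hθ]
  · simp [fisherInformation, partialDeriv_zero_one_log_density hθ, integral_div, mean]
  · simp [fisherInformation, partialDeriv_one_zero_log_density hθ, integral_div, mean]
  · simp only [fisherInformation, Matrix.of_apply, Fin.mk_one, partialDeriv_one_one_log_density hθ,
      neg_sub, Matrix.diagonal_apply_eq, Matrix.cons_val_one, Matrix.cons_val_fin_one]
    rw [integral_sub (integrable_sq.div_const _) (integrable_const _), integral_div, variance]
    simp only [integral_const, probReal_univ, one_smul]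
    field_simp
    norm_num

theorem sqrt_fisherInformation (hθ : θ ∈ paramSpace) :
    CFC.sqrt (fisherInformation θ) = Matrix.diagonal ![1 / √(θ 1), 1 / (√2 * θ 1)] := by
  have hθ₁ : 0 < θ 1 := hθ
  refine CFC.sqrt_unique ?_ (Matrix.nonneg_iff_posSemidef.2 (Matrix.PosSemidef.diagonal ?_))
  · rw [fisherInformation_eq hθ, Matrix.diagonal_mul_diagonal]
    congr 1
    ext i
    fin_cases i
    · simp only [Fin.zero_eta, Matrix.cons_val_zero]
      rw [div_mul_div_comm, Real.mul_self_sqrt hθ₁.le, one_mul]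
    · simp only [Fin.mk_one, Matrix.cons_val_one, Matrix.cons_val_fin_one]
      rw [div_mul_div_comm, mul_mul_mul_comm, Real.mul_self_sqrt zero_le_two, one_mul, sq]
  · intro i
    fin_cases i <;> simp [hθ₁.le]

theorem standardize_zero (n : ℕ) (hθ : θ ∈ paramSpace) (t : EuclideanSpace ℝ (Fin 2)) :
    standardize n θ t 0 = √n * ((t 0 - θ 0) / √(θ 1)) := by
  simp [standardize, sqrt_fisherInformation hθ, Matrix.mulVec_diagonal, div_eq_inv_mul, mul_sub]

theorem standardize_one (n : ℕ) (hθ : θ ∈ paramSpace) (t : EuclideanSpace ℝ (Fin 2)) :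
    standardize n θ t 1 = √n * ((t 1 - θ 1) / (√2 * θ 1)) := by
  simp [standardize, sqrt_fisherInformation hθ, Matrix.mulVec_diagonal, div_eq_inv_mul, mul_sub]

end Fisher

section MaximumLikelihood

variable {n : ℕ} {x : Fin n → ℝ} {θ : EuclideanSpace ℝ (Fin 2)}

theorem estimator_zero (x : Fin n → ℝ) : estimator x 0 = sampleMean x := rfl

theorem estimator_one (x : Fin n → ℝ) :
    estimator x 1 = (∑ i, (x i - sampleMean x) ^ 2) / n := rfl

theorem sum_sub_sq [NeZero n] (x : Fin n → ℝ) (m : ℝ) :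
    ∑ i, (x i - m) ^ 2 = n * (estimator x 1 + (estimator x 0 - m) ^ 2) := by
  have hn : (n : ℝ) ≠ 0 := Nat.cast_ne_zero.2 (NeZero.ne n)
  have sum_eq : ∑ i, x i = n * sampleMean x := by rw [sampleMean]; field_simp
  have expand (i) : (x i - m) ^ 2 = (x i - sampleMean x) ^ 2 + 2 * (sampleMean x - m) * x i
      + (m ^ 2 - sampleMean x ^ 2) := by ring
  rw [Finset.sum_congr rfl fun i _ => expand i, Finset.sum_add_distrib, Finset.sum_add_distrib,
    ← Finset.mul_sum, sum_eq, Finset.sum_const, Finset.card_univ, Fintype.card_fin, nsmul_eq_mul,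
    estimator_zero, estimator_one]
  field_simp
  ring

theorem log_likelihood [NeZero n] (x : Fin n → ℝ) (hθ : θ ∈ paramSpace) :
    Real.log (likelihood x θ) = -(n / 2) * (Real.log (2 * Real.pi)
      + (Real.log (θ 1) + (estimator x 1 + (estimator x 0 - θ 0) ^ 2) / θ 1)) := by
  rw [likelihood, Real.log_prod fun i _ => (density_pos hθ (x i)).ne',
    Finset.sum_congr rfl fun i _ => log_density hθ (x i), Finset.sum_sub_distrib,
    ← Finset.sum_div, sum_sub_sq]
  simp only [Finset.sum_const, Finset.card_univ, Fintype.card_fin, nsmul_eq_mul]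
  ring

theorem likelihood_pos (x : Fin n → ℝ) (hθ : θ ∈ paramSpace) : 0 < likelihood x θ :=
  Finset.prod_pos fun i _ => density_pos hθ (x i)

theorem log_add_one_lt_log_add_div {s v d : ℝ} (hs : 0 < s) (hv : 0 < v) (hne : s = v → d ≠ 0) :
    Real.log s + 1 < Real.log v + (s + d ^ 2) / v := by
  have log_div : Real.log (s / v) = Real.log s - Real.log v := Real.log_div hs.ne' hv.ne'
  rw [add_div]
  by_cases hsv : s = v
  · have : 0 < d ^ 2 / v := div_pos (sq_pos_of_ne_zero (hne hsv)) hv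
    rw [hsv, div_self hv.ne']
    linarith
  · have : 0 ≤ d ^ 2 / v := by positivity
    linarith [Real.log_lt_sub_one_of_pos (div_pos hs hv) (mt (div_eq_one_iff_eq hv.ne').1 hsv)]

theorem likelihood_lt_likelihood_estimator [NeZero n] (hx : 0 < estimator x 1)
    (hθ : θ ∈ paramSpace) (hne : θ ≠ estimator x) :
    likelihood x θ < likelihood x (estimator x) := by
  have hn : (0 : ℝ) < n := Nat.cast_pos.2 (NeZero.pos n)
  have key := log_add_one_lt_log_add_div (d := estimator x 0 - θ 0) hx hθ fun h₁ h₀ =>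
    hne (PiLp.ext (Fin.forall_fin_two.2 ⟨(sub_eq_zero.1 h₀).symm, h₁.symm⟩))
  rw [← Real.log_lt_log_iff (likelihood_pos x hθ) (likelihood_pos x hx), log_likelihood x hθ,
    log_likelihood x hx, sub_self, zero_pow two_ne_zero, add_zero, div_self hx.ne']
  exact mul_lt_mul_of_neg_left (by gcongr) (by linarith)

theorem isMLE_iff_eq_estimator [NeZero n] (hx : 0 < estimator x 1)
    (t : EuclideanSpace ℝ (Fin 2)) : IsMLE x t ↔ t = estimator x := by
  constructor
  · rintro ⟨ht, hmax⟩
    by_contra hne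
    exact (likelihood_lt_likelihood_estimator hx ht hne).not_ge (hmax hx)
  · rintro rfl
    refine ⟨hx, fun θ hθ => ?_⟩
    obtain rfl | hne := eq_or_ne θ (estimator x)
    · exact le_refl (likelihood x _)
    · exact (likelihood_lt_likelihood_estimator hx hθ hne).le

theorem estimator_one_pos {i j : Fin n} (hij : x i ≠ x j) : 0 < estimator x 1 := by
  have sum_nonneg : 0 ≤ ∑ k, (x k - sampleMean x) ^ 2 := Finset.sum_nonneg fun k _ => sq_nonneg _
  refine div_pos (sum_nonneg.lt_of_ne' fun hzero => hij ?_) (Nat.cast_pos.2 i.pos)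
  rw [Finset.sum_eq_zero_iff_of_nonneg fun k _ => sq_nonneg _] at hzero
  have eq_mean (k) : x k = sampleMean x :=
    sub_eq_zero.1 (pow_eq_zero_iff two_ne_zero |>.1 (hzero k (Finset.mem_univ k)))
  rw [eq_mean i, eq_mean j]

end MaximumLikelihood

section AlmostSure

variable {Ω : Type*} [MeasurableSpace Ω] {P : Measure Ω}

theorem ae_ne_of_indepFun [IsFiniteMeasure P] {X Y : Ω → ℝ} {ν : Measure ℝ}
    [NullSingletonClass ν] (hX : AEMeasurable X P) (hY : HasLaw Y ν P) (hind : IndepFun X Y P) :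
    ∀ᵐ ω ∂P, X ω ≠ Y ω := by
  have offDiag : MeasurableSet {p : ℝ × ℝ | p.1 ≠ p.2} :=
    (measurableSet_eq_fun measurable_fst measurable_snd).compl
  have ae_prod : ∀ᵐ p ∂((P.map X).prod (P.map Y)), p.1 ≠ p.2 := by
    rw [Measure.ae_prod_iff_ae_ae offDiag, hY.map_eq]
    exact ae_of_all _ fun a => by simp [ae_iff]
  rw [← (indepFun_iff_map_prod_eq_prod_map_map hX hY.aemeasurable).1 hind,
    ae_map_iff (hX.prodMk hY.aemeasurable) offDiag] at ae_prod
  exact ae_prod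

theorem ae_isMLE_iff_eq_estimator {n : ℕ} (hn : 2 ≤ n)
    {X : Fin n → Ω → ℝ} {ν : Measure ℝ} [NullSingletonClass ν] (hlaw : ∀ i, HasLaw (X i) ν P)
    (hind : iIndepFun X P) :
    ∀ᵐ ω ∂P, ∀ t, IsMLE (fun i => X i ω) t ↔ t = estimator fun i => X i ω := by
  have := hind.isProbabilityMeasure
  have : NeZero n := ⟨by omega⟩
  have hne : (⟨0, by omega⟩ : Fin n) ≠ ⟨1, by omega⟩ := by simp
  filter_upwards [ae_ne_of_indepFun (hlaw _).aemeasurable (hlaw _) (hind.indepFun hne)]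
    with ω hω
  exact isMLE_iff_eq_estimator (estimator_one_pos hω)

end AlmostSure

section Decomposition

variable {n : ℕ}

/-- The difference between the standardized estimator and the normalized sum of the score vectors,
as a function of the standardized data `y`; it comes from replacing `μ` by the sample mean in the
estimator of the variance. -/
noncomputable def meanCorrection (y : Fin n → ℝ) : EuclideanSpace ℝ (Fin 2) :=
  EuclideanSpace.single 1 (-((∑ i, y i) ^ 2 / (√2 * √n * n)))

variable [NeZero n]

theorem estimator_affine_zero (y : Fin n → ℝ) (a b : ℝ) :
    estimator (fun i => a + b * y i) 0 = a + b * estimator y 0 := by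
  have hn : (n : ℝ) ≠ 0 := Nat.cast_ne_zero.2 (NeZero.ne n)
  simp only [estimator_zero, sampleMean, Finset.sum_add_distrib, ← Finset.mul_sum,
    Finset.sum_const, Finset.card_univ, Fintype.card_fin, nsmul_eq_mul]
  field_simp

theorem estimator_affine_one (y : Fin n → ℝ) (a b : ℝ) :
    estimator (fun i => a + b * y i) 1 = b ^ 2 * estimator y 1 := by
  have mean := estimator_affine_zero y a b
  simp only [estimator_zero] at mean
  simp only [estimator_one, mean, add_sub_add_left_eq_sub, ← mul_sub, mul_pow, ← Finset.mul_sum,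
    mul_div_assoc]

theorem estimator_one_eq_sub (y : Fin n → ℝ) :
    estimator y 1 = (∑ i, y i ^ 2) / n - ((∑ i, y i) / n) ^ 2 := by
  have hn : (n : ℝ) ≠ 0 := Nat.cast_ne_zero.2 (NeZero.ne n)
  have key := sum_sub_sq y 0
  simp only [sub_zero] at key
  rw [key, mul_div_cancel_left₀ _ hn, estimator_zero, sampleMean, add_sub_cancel_right]

theorem standardize_estimator_affine {θ : EuclideanSpace ℝ (Fin 2)} (hθ : θ ∈ paramSpace)
    (y : Fin n → ℝ) :
    standardize n θ (estimator fun i => θ 0 + √(θ 1) * y i)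
      = (√n)⁻¹ • ∑ i, scoreVector (y i) + meanCorrection y := by
  have hθ₁ : 0 < θ 1 := hθ
  have sqrt_ne_zero : √(θ 1) ≠ 0 := (Real.sqrt_pos.2 hθ₁).ne'
  have hn : √(n : ℝ) ≠ 0 := (Real.sqrt_pos.2 (mod_cast NeZero.pos n)).ne'
  have hn_sq : (n : ℝ) = √n ^ 2 := (Real.sq_sqrt n.cast_nonneg).symm
  refine PiLp.ext (Fin.forall_fin_two.2 ⟨?_, ?_⟩)
  · rw [standardize_zero n hθ, estimator_affine_zero, add_sub_cancel_left, estimator_zero,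
      sampleMean, mul_div_cancel_left₀ _ sqrt_ne_zero]
    simp only [meanCorrection, PiLp.add_apply, PiLp.smul_apply, WithLp.ofLp_sum,
      Finset.sum_apply, scoreVector_zero, smul_eq_mul, ne_eq, zero_ne_one, not_false_eq_true,
      PiLp.single_eq_of_ne, add_zero]
    generalize √(n : ℝ) = r at *
    rw [hn_sq]
    field_simp
  · rw [standardize_one n hθ, estimator_affine_one, estimator_one_eq_sub, Real.sq_sqrt hθ₁.le]
    simp only [meanCorrection, PiLp.add_apply, PiLp.smul_apply, WithLp.ofLp_sum,
      Finset.sum_apply, scoreVector_one, ← Finset.sum_div, Finset.sum_sub_distrib,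
      Finset.sum_const, Finset.card_univ, Fintype.card_fin, nsmul_eq_mul, mul_one, smul_eq_mul,
      PiLp.single_eq_same]
    generalize √(n : ℝ) = r at *
    rw [hn_sq]
    field_simp
    ring

theorem standardize_estimator {θ : EuclideanSpace ℝ (Fin 2)} (hθ : θ ∈ paramSpace)
    (x : Fin n → ℝ) :
    standardize n θ (estimator x)
      = (√n)⁻¹ • ∑ i, scoreVector ((x i - θ 0) / √(θ 1))
        + meanCorrection fun i => (x i - θ 0) / √(θ 1) := by
  have sqrt_ne_zero : √(θ 1) ≠ 0 := (Real.sqrt_pos.2 hθ).ne'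
  simpa only [mul_div_cancel₀ _ sqrt_ne_zero, add_sub_cancel] using
    standardize_estimator_affine hθ fun i => (x i - θ 0) / √(θ 1)

end Decomposition

section NormalApproximation

variable {Ω : Type*} [MeasurableSpace Ω] {P : Measure Ω} {n : ℕ}
  {θ : EuclideanSpace ℝ (Fin 2)}

theorem integral_sum_sq_of_indepFun {ι : Type*} [Fintype ι] [IsProbabilityMeasure P]
    {Y : ι → Ω → ℝ} (hY : ∀ i, MemLp (Y i) 2 P) (mean : ∀ i, ∫ ω, Y i ω ∂P = 0)
    (hind : Pairwise fun i j => IndepFun (Y i) (Y j) P) :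
    ∫ ω, (∑ i, Y i ω) ^ 2 ∂P = ∑ i, ∫ ω, Y i ω ^ 2 ∂P := by
  have mean_sum : ∫ ω, (∑ i, Y i) ω ∂P = 0 := by
    simp only [Finset.sum_apply]
    rw [integral_finsetSum _ fun i _ => (hY i).integrable one_le_two]
    exact Finset.sum_eq_zero fun i _ => mean i
  have key := IndepFun.variance_sum (s := Finset.univ) (fun i _ => hY i) fun i _ j _ hij => hind hij
  rw [variance_of_integral_eq_zero (memLp_finsetSum' _ fun i _ => hY i).aemeasurable
    mean_sum] at key
  simpa only [Finset.sum_apply,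
    fun i => variance_of_integral_eq_zero (hY i).aemeasurable (mean i)] using key

theorem integrable_meanCorrection {Y : Fin n → Ω → ℝ} (hY : ∀ i, MemLp (Y i) 2 P) :
    Integrable (fun ω => meanCorrection fun i => Y i ω) P := by
  have key := ((memLp_finsetSum Finset.univ fun i _ => hY i).integrable_sq.div_const
    (√2 * √n * n)).neg
  refine Integrable.of_eval_piLp fun j => ?_
  fin_cases j
  · simp [meanCorrection]
  · simpa [meanCorrection] using key

theorem hasLaw_sub_div_sqrt {X : Ω → ℝ} (hθ : θ ∈ paramSpace) (hX : HasLaw X (law θ) P) :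
    HasLaw (fun ω => (X ω - θ 0) / √(θ 1)) (gaussianReal 0 1) P := by
  have hθ₁ : 0 < θ 1 := hθ
  convert gaussianReal_div_const (gaussianReal_sub_const hX (θ 0)) √(θ 1) using 1
  congr 1
  · simp
  · ext
    simp [Real.sq_sqrt hθ₁.le, hθ₁.le, hθ₁.ne']

theorem memLp_two_of_hasLaw_stdNormal {Y : Ω → ℝ} (hY : HasLaw Y (gaussianReal 0 1) P) :
    MemLp Y 2 P := by
  have key := memLp_id_gaussianReal (μ := 0) (v := 1) 2
  rw [← hY.map_eq] at key
  exact key.comp_of_map hY.aemeasurable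

variable {Y : Fin n → Ω → ℝ}

theorem integrable_smul_sum_scoreVector [IsFiniteMeasure P] (c : ℝ)
    (hY : ∀ i, HasLaw (Y i) (gaussianReal 0 1) P) :
    Integrable (fun ω => c • ∑ i, scoreVector (Y i ω)) P :=
  (integrable_finsetSum _ fun i _ =>
    (isStandardized_scoreVector.comp_hasLaw (hY i)).integrable).smul c

variable [NeZero n]

theorem integral_sum_abs_meanCorrection (hY : ∀ i, HasLaw (Y i) (gaussianReal 0 1) P)
    (hind : iIndepFun Y P) :
    ∫ ω, ∑ j, |meanCorrection (fun i => Y i ω) j| ∂P = 1 / (√2 * √n) := by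
  have hn : (n : ℝ) ≠ 0 := Nat.cast_ne_zero.2 (NeZero.ne n)
  have := hind.isProbabilityMeasure
  have second_moment (i) : ∫ ω, Y i ω ^ 2 ∂P = 1 := by
    refine ((hY i).integral_comp (f := fun y => y ^ 2) (by fun_prop)).trans ?_
    simpa using integral_pow_two_mul_gaussianReal 1 1
  have key := integral_sum_sq_of_indepFun (fun i => memLp_two_of_hasLaw_stdNormal (hY i))
    (fun i => by rw [(hY i).integral_eq, integral_id_gaussianReal]) fun _ _ => hind.indepFun
  have sum_abs (ω) : ∑ j, |meanCorrection (fun i => Y i ω) j|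
      = (∑ i, Y i ω) ^ 2 / (√2 * √n * n) := by
    have nonneg : 0 ≤ (∑ i, Y i ω) ^ 2 / (√2 * √n * n) := by positivity
    simp [meanCorrection, Fin.sum_univ_two, abs_of_nonneg nonneg]
  simp only [sum_abs, integral_div, key, second_moment, Finset.sum_const, Finset.card_univ,
    Fintype.card_fin, nsmul_eq_mul]
  field_simp

variable {X : Fin n → Ω → ℝ}

theorem integrable_standardize_estimator [IsFiniteMeasure P] (hθ : θ ∈ paramSpace)
    (hX : ∀ i, HasLaw (X i) (law θ) P) :
    Integrable (fun ω => standardize n θ (estimator fun i => X i ω)) P := by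
  have hY := fun i => hasLaw_sub_div_sqrt hθ (hX i)
  simp only [standardize_estimator hθ]
  exact (integrable_smul_sum_scoreVector _ hY).add
    (integrable_meanCorrection fun i => memLp_two_of_hasLaw_stdNormal (hY i))

theorem IsTestFunction.abs_integral_standardize_estimator_sub_le
    {h : EuclideanSpace ℝ (Fin 2) → ℝ} (hh : IsTestFunction h) (hθ : θ ∈ paramSpace)
    (hX : ∀ i, HasLaw (X i) (law θ) P) (hind : iIndepFun X P) :
    |∫ ω, h (standardize n θ (estimator fun i => X i ω)) ∂P - ∫ x, h x ∂(stdGaussian _)| ≤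
      28 / 3 / √n * (supNorm₃ h).toReal + 1 / (√2 * √n) * (supNorm₁ h).toReal := by
  have := hind.isProbabilityMeasure
  have hY := fun i => hasLaw_sub_div_sqrt hθ (hX i)
  have hYind : iIndepFun (fun i ω => (X i ω - θ 0) / √(θ 1)) P :=
    hind.comp (fun _ x => (x - θ 0) / √(θ 1)) fun _ => by fun_prop
  have perturbation := hh.abs_integral_add_sub_le (integrable_smul_sum_scoreVector (√n)⁻¹ hY)
    (integrable_meanCorrection fun i => memLp_two_of_hasLaw_stdNormal (hY i))
  rw [integral_sum_abs_meanCorrection hY hYind] at perturbation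
  have normal_approximation := hh.abs_integral_sum_scoreVector_sub_le hY hYind
  simp only [standardize_estimator hθ]
  refine (abs_sub_le _ _ _).trans ((add_le_add perturbation normal_approximation).trans_eq ?_)
  ring

end NormalApproximation

theorem ofReal_mul_toReal_le {a b : ℝ} (hab : a ≤ b) (s : ℝ≥0∞) :
    ENNReal.ofReal (a * s.toReal) ≤ ENNReal.ofReal b * s := by
  rw [ENNReal.ofReal_mul' ENNReal.toReal_nonneg]
  gcongr
  exact ENNReal.ofReal_toReal_le

end NormalMLE

theorem mainTheorem4 {Ω Ω' : Type*} [MeasurableSpace Ω] [MeasurableSpace Ω']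
    (P : Measure Ω) [IsProbabilityMeasure P] (Q : Measure Ω') [IsProbabilityMeasure Q]
    (n : ℕ) (hn : 1 ≤ n) (μ σ : ℝ) (hσ : 0 < σ)
    (θ₀ : EuclideanSpace ℝ (Fin 2)) (hθ₀ : θ₀ = !₂[μ, σ ^ 2])
    (X : Fin n → Ω → ℝ) (hlaw : ∀ i, HasLaw (X i) (NormalMLE.law θ₀) P) (hindep : iIndepFun X P)
    (Z : Ω' → EuclideanSpace ℝ (Fin 2))
    (hZ : HasLaw Z (stdGaussian (EuclideanSpace ℝ (Fin 2))) Q)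
    (θhat : Ω → EuclideanSpace ℝ (Fin 2))
    (hθhat : ∀ ω, θhat ω = NormalMLE.estimator fun i => X i ω) :
    (2 ≤ n → ∀ᵐ ω ∂P, ∀ t, NormalMLE.IsMLE (fun i => X i ω) t ↔ t = θhat ω) ∧
    ∀ h : EuclideanSpace ℝ (Fin 2) → ℝ, NormalMLE.IsTestFunction h →
      Integrable (fun ω => h (NormalMLE.standardize n θ₀ (θhat ω))) P ∧
      Integrable (fun ω => h (Z ω)) Q ∧
      ENNReal.ofReal |∫ ω, h (NormalMLE.standardize n θ₀ (θhat ω)) ∂P - ∫ ω, h (Z ω) ∂Q| ≤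
        ENNReal.ofReal (5 / 2 / √n) * NormalMLE.supNorm₂ h
        + ENNReal.ofReal (19 / √n) * NormalMLE.supNorm₃ h
        + ENNReal.ofReal (8 / (n * σ ^ 2) * (1 + 2 * σ ^ 2)) * NormalMLE.supNorm h
        + ENNReal.ofReal (4 * √2 / √n) * NormalMLE.supNorm₁ h
        + ENNReal.ofReal (4 / √n * (√2 + √(3 / 2) + 16 * √2 * √(1 / n + σ ^ 2 / 4)))
          * NormalMLE.supNorm₁ h
        + ENNReal.ofReal (32 / √n * √(1 + 648 * ((3 / 2 + σ ^ 2 / 4) ^ 2 + 3 / (n : ℝ) ^ 2)))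
          * NormalMLE.supNorm₁ h := by
  have : NeZero n := ⟨by omega⟩
  have hθ : θ₀ ∈ NormalMLE.paramSpace := by simp [NormalMLE.paramSpace, hθ₀, hσ]
  have := NormalMLE.nullSingletonClass_law hθ
  obtain rfl : θhat = fun ω => NormalMLE.estimator fun i => X i ω := funext hθhat
  refine ⟨fun h₂ => NormalMLE.ae_isMLE_iff_eq_estimator h₂ hlaw hindep, fun h hh => ⟨?_, ?_, ?_⟩⟩
  · exact NormalMLE.integrable_comp_of_lipschitzWith hh.lipschitzWith
      (NormalMLE.integrable_standardize_estimator hθ hlaw)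
  · exact NormalMLE.integrable_comp_of_lipschitzWith hh.lipschitzWith
      (NormalMLE.isStandardized_stdGaussian.comp_hasLaw hZ).integrable
  · have bound := hh.abs_integral_standardize_estimator_sub_le hθ hlaw hindep
    rw [← hZ.integral_comp hh.differentiable.continuous.aestronglyMeasurable] at bound
    have constant_le : 1 / (√2 * √n) ≤ 4 * √2 / √n := by
      rw [← div_div]
      gcongr
      rw [div_le_iff₀ (by positivity), mul_assoc, Real.mul_self_sqrt zero_le_two]
      norm_num
    calc _ ≤ ENNReal.ofReal (19 / √n) * NormalMLE.supNorm₃ h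
          + ENNReal.ofReal (4 * √2 / √n) * NormalMLE.supNorm₁ h :=
        (ENNReal.ofReal_le_ofReal bound).trans <| ENNReal.ofReal_add_le.trans <| add_le_add
          (NormalMLE.ofReal_mul_toReal_le (by gcongr; norm_num) _)
          (NormalMLE.ofReal_mul_toReal_le constant_le _)
      _ ≤ _ := by
        refine le_trans ?_ (le_self_add.trans le_self_add)
        gcongr
        exact le_add_self.trans le_self_add
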